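/- **Theorem 1.1** (Conjecture 4.7 of Armstrong–Rhoades–Williams). Let $a<b$ be coprime positive integers. The simplicial complex $\widehat{\mathsf{Ass}}(a,b)$ collapses onto its subcomplex $\mathsf{Ass}(a,b)$. Here the terms are as follows. *Complexes.* A simplicial complex on a finite ground set $E$ is a collection $\Delta$ of subsets of $E$ (faces) closed under taking subsets. A pair $(F,F')$ is *free* in $\Delta$ if $F$ is an inclusion-maximal face, $F'\subset F$ is a face with $|F'|=|F|-1$, and $F$ is the only face of $\Delta$ properly containing $F'$; then $\Delta\setminus\{F,F'\}$ is obtained from $\Delta$ by an *elementary collapse*. $\Delta$ *collapses onto* $\Delta'$ if $\Delta'$ is obtained from $\Delta$ by a finite (possibly empty) sequence of elementary collapses. *Diagonals.* Label the vertices of a convex $(b+1)$-gon $0,1,\dots,b$ in clockwise order. A diagonal $ij$ ($i<j$) is a segment other than a side joining the vertices $i$ and $j$; diagonals $ij$ and $km$ *cross* if $i<k<j<m$ or $k<i<m<j$. Let $S(a,b)=\{\lfloor ib/a\rfloor : i=1,\dots,a-1\}$. A diagonal that has $p$ vertices strictly on one side and $q$ vertices strictly on the other is *$a,b$-admissible*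 if $p,q\in S(a,b)$. *The complex $\widehat{\mathsf{Ass}}(a,b)$.* Its ground set is the set of $a,b$-admissible diagonals, and its faces are the sets of pairwise noncrossing $a,b$-admissible diagonals. *The complex $\mathsf{Ass}(a,b)$.* An $a,b$-Dyck path $D$ is a lattice path from $(0,0)$ to $(b,a)$ with unit north and east steps that stays weakly above the line $y=\frac ab x$. Let $P=(i,j)\neq(0,0)$ be a lattice point on $D$ at the bottom of a north step of $D$. The *laser* of $P$ is the segment of slope $\frac ab$ whose southwest endpoint is $P$, whose northeast endpoint lies on $D$, and whose interior does not meet $D$; its northeast endpoint lies in the interior of an east step of $D$, and if $(k,m)$ is the right endpoint of this step, put $d(P)=ik$, which is an $a,b$-admissible diagonal. Let $\mathcal F(D)$ be the set of all the diagonals $d(P)$. The complex $\mathsf{Ass}(a,b)$, on the ground set of $a,b$-admissible diagonals, has as its faces all subsets of the sets $\mathcal F(D)$, where $D$ ranges over the $a,b$-Dyck paths. -/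

import Mathlib

namespace RationalAss

/-! ### Simplicial complexes and collapsing -/

/-- A simplicial complex on the ground set `E`: a collection of finite subsets of `E` that is closed
under passing to subsets. The empty set is a face of every nonempty complex, and an element of the
ground set need not be a face. -/
abbrev SimplicialComplex (E : Type) := LowerSet (Finset E)

variable {E : Type}

/-- `F` is a facet of `Δ`: a maximal face. -/
def IsFacet (Δ : SimplicialComplex E) (F : Finset E) : Prop :=
  Maximal (fun G => G ∈ Δ) F

/-- `(F, F')` is a free pair of `Δ`: `F` is a facet, `F' ⊂ F` is a face of dimension one less, and
`F` is the only face of `Δ` that properly contains `F'`. -/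
def IsFreePair (Δ : SimplicialComplex E) (F F' : Finset E) : Prop :=
  IsFacet Δ F ∧ F' ∈ Δ ∧ F' ⊂ F ∧ F'.card + 1 = F.card ∧ ∀ G ∈ Δ, F' ⊂ G → G = F

/-- `Δ'` is obtained from `Δ` by an elementary collapse, i.e. by removing the two faces of a free
pair. -/
def ElementaryCollapse (Δ Δ' : SimplicialComplex E) : Prop :=
  ∃ F F' : Finset E, IsFreePair Δ F F' ∧
    (Δ' : Set (Finset E)) = (Δ : Set (Finset E)) \ {F, F'}

/-- `Δ` collapses onto `Δ'`: there is a finite (possibly empty) sequence of elementary collapses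
leading from `Δ` to `Δ'`. -/
def CollapsesOnto (Δ Δ' : SimplicialComplex E) : Prop :=
  Relation.ReflTransGen ElementaryCollapse Δ Δ'

/-! ### Diagonals of the polygon with boundary points `0, 1, …, b` -/

/-- `S(a,b) = {⌊ib/a⌋ : i = 1, …, a - 1}`; the division of natural numbers is the floor of the
quotient. -/
def S (a b : ℕ) : Finset ℕ := (Finset.Ico 1 a).image fun i => i * b / a

/-- The pair `d = (i, j)` is a diagonal of the `(b+1)`-gon with points `0, …, b` in cyclic order:
`i < j` are points and `ij` is not one of the sides `01, 12, …, (b-1)b, 0b`. -/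
def IsDiagonal (b : ℕ) (d : ℕ × ℕ) : Prop :=
  d.1 < d.2 ∧ d.2 ≤ b ∧ d.1 + 1 ≠ d.2 ∧ ¬ (d.1 = 0 ∧ d.2 = b)

/-- The diagonals `ij` and `km` cross. -/
def Cross (d e : ℕ × ℕ) : Prop :=
  (d.1 < e.1 ∧ e.1 < d.2 ∧ d.2 < e.2) ∨ (e.1 < d.1 ∧ d.1 < e.2 ∧ e.2 < d.2)

/-- The pair `d` is an `a,b`-admissible diagonal: the numbers of boundary points on its two sides
both belong to `S(a,b)`. -/
def IsAdmissible (a b : ℕ) (d : ℕ × ℕ) : Prop :=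
  IsDiagonal b d ∧
    ((Finset.range (b + 1)).filter fun p => d.1 < p ∧ p < d.2).card ∈ S a b ∧
    ((Finset.range (b + 1)).filter fun p => p < d.1 ∨ d.2 < p).card ∈ S a b

/-- The set of `a,b`-admissible diagonals. -/
abbrev AdmissibleDiagonal (a b : ℕ) : Type := {d : ℕ × ℕ // IsAdmissible a b d}

/-- The complex `Âss(a,b)`: its faces are the sets of mutually noncrossing `a,b`-admissible
diagonals. -/
def AssHat (a b : ℕ) : SimplicialComplex (AdmissibleDiagonal a b) where
  carrier := {F | ∀ d ∈ F, ∀ e ∈ F, ¬ Cross d.1 e.1}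
  lower' := fun _ _ hGF hF d hd e he => hF d (hGF hd) e (hGF he)

/-! ### Rational Dyck paths and their lasers -/

/-- An `a,b`-Dyck path, given by the lattice points that it visits: it runs from `(0,0)` to `(b,a)`
by unit north and east steps and stays (weakly) above the line `y = (a/b) x`. -/
structure DyckPath (a b : ℕ) where
  pt : Fin (a + b + 1) → ℕ × ℕ
  start : pt 0 = (0, 0)
  finish : pt (Fin.last (a + b)) = (b, a)
  step : ∀ t : Fin (a + b),
    pt t.succ = pt t.castSucc + (0, 1) ∨ pt t.succ = pt t.castSucc + (1, 0)
  above : ∀ t, a * (pt t).1 ≤ b * (pt t).2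

/-- A lattice point as a point of the real plane. -/
def toPlane (p : ℕ × ℕ) : ℝ × ℝ := ((p.1 : ℝ), (p.2 : ℝ))

namespace DyckPath

variable {a b : ℕ}

/-- The path as a subset of the plane, the union of its steps. -/
def curve (D : DyckPath a b) : Set (ℝ × ℝ) :=
  ⋃ t : Fin (a + b), segment ℝ (toPlane (D.pt t.castSucc)) (toPlane (D.pt t.succ))

/-- The step of `D` from `P` to `R` is a north step. -/
def NorthStep (D : DyckPath a b) (P R : ℕ × ℕ) : Prop :=
  ∃ t : Fin (a + b), D.pt t.castSucc = P ∧ D.pt t.succ = R ∧ R = P + (0, 1)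

/-- The step of `D` from `P` to `R` is an east step. -/
def EastStep (D : DyckPath a b) (P R : ℕ × ℕ) : Prop :=
  ∃ t : Fin (a + b), D.pt t.castSucc = P ∧ D.pt t.succ = R ∧ R = P + (1, 0)

/-- `P` is a point from which a laser is fired: a lattice point on `D`, other than the origin, at
the bottom of a north step. -/
def FiresLaser (D : DyckPath a b) (P : ℕ × ℕ) : Prop :=
  P ≠ (0, 0) ∧ ∃ R, D.NorthStep P R

/-- The laser of `P` is the line segment from `P` to `Q`: it has slope `a/b`, its southwest endpoint
is `P`, its northeast endpoint `Q` lies on `D`, and its interior does not meet `D`. -/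
def IsLaser (D : DyckPath a b) (P : ℕ × ℕ) (Q : ℝ × ℝ) : Prop :=
  (P.1 : ℝ) < Q.1 ∧ Q.2 - P.2 = (a / b : ℝ) * (Q.1 - P.1) ∧
    Q ∈ D.curve ∧ Disjoint (openSegment ℝ (toPlane P) Q) D.curve

/-- `d = (i, k)` is the diagonal `d(P)` of the point `P = (i, j)`: the northeast endpoint of the
laser of `P` lies in the interior of the east step of `D` whose right endpoint is `(k, m)`. -/
def IsLaserDiagonal (D : DyckPath a b) (P d : ℕ × ℕ) : Prop :=
  d.1 = P.1 ∧ ∃ Q : ℝ × ℝ, D.IsLaser P Q ∧ ∃ L R : ℕ × ℕ, D.EastStep L R ∧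
    Q ∈ openSegment ℝ (toPlane L) (toPlane R) ∧ d.2 = R.1

lemma pt_le (D : DyckPath a b) (t : Fin (a + b + 1)) : D.pt t ≤ (b, a) := by
  have hm : Monotone D.pt := Fin.monotone_iff_le_succ.2 fun t => by
    rcases D.step t with h | h <;> rw [h] <;> exact le_self_add
  exact D.finish ▸ hm (Fin.le_last t)

/-- The diagonal of a point that fires a laser is an `a,b`-admissible diagonal. -/
lemma IsLaserDiagonal.isAdmissible (ha : 0 < a) (hab : a < b) {D : DyckPath a b} {P d : ℕ × ℕ}
    (hP : D.FiresLaser P) (hd : D.IsLaserDiagonal P d) : IsAdmissible a b d := by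
  obtain ⟨i, j⟩ := P
  obtain ⟨i', k⟩ := d
  obtain ⟨hP0, R', t', ht', -, -⟩ := hP
  obtain ⟨h1, ⟨q1, q2⟩, ⟨hq, hslope, -, -⟩, ⟨l, m⟩, R, ⟨t, -, htR, hR⟩, hQ, hk⟩ := hd
  subst hR
  have hRle := htR ▸ D.pt_le t.succ
  have habove := ht' ▸ D.above t'.castSucc
  rw [openSegment_eq_image] at hQ
  obtain ⟨θ, ⟨hθ0, hθ1⟩, hθ⟩ := hQ
  simp only [toPlane, Prod.mk_add_mk, Prod.smul_mk, Prod.mk.injEq, smul_eq_mul, Prod.mk_le_mk,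
    add_zero, Nat.cast_add, Nat.cast_one, ne_eq] at *
  subst h1 hk
  obtain ⟨hx, hy⟩ := hθ
  have hbR : (0 : ℝ) < b := by exact_mod_cast (by omega : 0 < b)
  have haR : (0 : ℝ) < a := by exact_mod_cast ha
  have hq2 : q2 = m := by linarith
  have hq1 : q1 = l + θ := by linarith
  have hmul : (b : ℝ) * (m - j) = a * (q1 - i') := by
    rw [← hq2, hslope]; field_simp
  have hjm : j < m := by
    have : (0 : ℝ) < b * (m - j) := by rw [hmul]; exact mul_pos haR (by linarith)
    have : (0 : ℝ) < m - j := pos_of_mul_pos_right this hbR.le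
    exact_mod_cast (by linarith : (j : ℝ) < m)
  have hil : i' ≤ l := by
    have : (i' : ℝ) < l + 1 := by linarith
    exact Nat.lt_succ_iff.1 (by exact_mod_cast this)
  have hj : 1 ≤ j := by
    rcases Nat.eq_zero_or_pos j with rfl | h
    · have : a * i' = 0 := by omega
      rcases Nat.mul_eq_zero.1 this with h | h
      · omega
      · exact absurd ⟨h, rfl⟩ hP0
    · exact h
  obtain ⟨e, rfl⟩ := Nat.exists_eq_add_of_le hil
  obtain ⟨c, rfl⟩ := Nat.exists_eq_add_of_lt hjm
  push_cast at hmul hq1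
  have hlo : e * a < (c + 1) * b := by
    have : (e : ℝ) * a < (c + 1) * b := by nlinarith
    exact_mod_cast this
  have hhi : (c + 1) * b < (e + 1) * a := by
    have : ((c : ℝ) + 1) * b < (e + 1) * a := by nlinarith
    exact_mod_cast this
  have hca : c + 1 < a := by omega
  obtain ⟨f, rfl⟩ := Nat.exists_eq_add_of_lt hca
  obtain ⟨g, hg⟩ := Nat.exists_eq_add_of_le (show e + 1 ≤ b by omega)
  have he : 1 ≤ e := by
    by_contra h
    obtain rfl : e = 0 := by omega
    nlinarith
  have hg1 : 1 ≤ g := by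
    by_contra h
    obtain rfl : g = 0 := by omega
    subst hg
    nlinarith
  refine ⟨⟨?_, ?_, ?_, ?_⟩, ?_, ?_⟩
  · simp only; omega
  · simp only; omega
  · simp only; omega
  · simp only; omega
  · have : ((Finset.range (b + 1)).filter fun p => i' < p ∧ p < i' + e + 1) =
        Finset.Ioo i' (i' + e + 1) := by
      ext p; simp; omega
    simp only [S, Finset.mem_image, this, Nat.card_Ioo]
    refine ⟨c + 1, by simp, ?_⟩
    rw [show i' + e + 1 - i' - 1 = e by omega]
    exact Nat.div_eq_of_lt_le hlo.le hhi
  · have : ((Finset.range (b + 1)).filter fun p => p < i' ∨ i' + e + 1 < p) =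
        Finset.range (b + 1) \ Finset.Icc i' (i' + e + 1) := by
      ext p; simp; omega
    simp only [S, Finset.mem_image, this]
    rw [Finset.card_sdiff_of_subset (by intro p; simp; omega), Nat.card_Icc, Finset.card_range]
    refine ⟨f + 1, by simp, ?_⟩
    rw [show b + 1 - (i' + e + 1 + 1 - i') = g by omega]
    subst hg
    exact Nat.div_eq_of_lt_le (by nlinarith) (by nlinarith)

/-- The set `F(D)` of the diagonals `d(P)`, for `P` at the bottom of a north step of `D`. (The
lemma `IsLaserDiagonal.isAdmissible` shows that every `d(P)` is admissible.) -/
def facet (D : DyckPath a b) : Set (AdmissibleDiagonal a b) :=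
  {d | ∃ P, D.FiresLaser P ∧ D.IsLaserDiagonal P d.1}

end DyckPath

/-- The complex `Ass(a,b)` generated by the sets `F(D)`: its faces are the subsets of the `F(D)`,
where `D` is an `a,b`-Dyck path. -/
def Ass (a b : ℕ) : SimplicialComplex (AdmissibleDiagonal a b) where
  carrier := {F | ∃ D : DyckPath a b, (F : Set (AdmissibleDiagonal a b)) ⊆ D.facet}
  lower' := fun _ _ hGF ⟨D, hD⟩ => ⟨D, fun _ hd => hD (hGF hd)⟩

end RationalAss

/-!
The complex `Ass a b` turns out to be a flag complex inside `AssHat a b`. To a diagonal `d = (i, k)`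
belongs its residue `a (k - i) mod b`. An admissible diagonal has residue strictly between `0` and
`a`, and a laser with diagonal `d` ends at distance `residue / a` from the right end of its east
step. Two lasers of one path that end in the same east step are nested, the one that starts further
left being the lower one and hence ending further left. So the diagonals `(i, k)` and `(i', k)` with
`i < i'` cannot come from one path if the residue of `(i', k)` is smaller than that of `(i, k)`;
they *clash*. Conversely every noncrossing set of admissible diagonals without a clash comes from a
path, whose height at `y` is `a` minus the largest total rise of a chain of diagonals between `y`
and `b`. This is proved in `ass_le_clashBelow_zero` and `clashBelow_zero_le_ass`.

If `(i, k)` and `(i', k)` clash, then `(i, i')` is admissible, since its residue is the difference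
of theirs. If moreover no other diagonal of the face joins `k` to a point between `i` and `i'`, then
no diagonal of the face crosses `(i, i')`, so `(i, i')` can be toggled. The faces that clash at `k`
and at no later point are matched in this way. The toggled diagonal depends only on the diagonals
with right endpoint `k` and is not among them, so the matching is acyclic
(`collapsesOnto_of_toggle`). Removing the clashes at `k = b, b - 1, …, 0` in turn collapses
`AssHat a b` onto the complex without clashes (`assHat_collapsesOnto_clashBelow_zero`).
-/

namespace RationalAss

/-! ### Collapsing along a matching -/

/-- A matching criterion for collapsibility. Suppose that every face `F` of `Δ` outside `Δ₀` can be
matched by toggling an element `y` that depends only on the part `F.filter p` of `F`, where `y`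
itself lies outside `p`, and that toggling `y` stays in `Δ` and outside `Δ₀`. Since `F.filter p` is
constant on matched pairs and monotone in `F`, the matching is acyclic, so `Δ` collapses
onto `Δ₀`. -/
theorem collapsesOnto_of_toggle {E : Type} [DecidableEq E] [Finite E] (p : E → Prop)
    [DecidablePred p] {Δ Δ₀ : SimplicialComplex E} (hle : Δ₀ ≤ Δ)
    (h : ∀ T : Finset E, (∃ F ∈ Δ, F ∉ Δ₀ ∧ F.filter p = T) → ∃ y, ¬ p y ∧
      ∀ F ∈ Δ, F ∉ Δ₀ → F.filter p = T → insert y F ∈ Δ ∧ F.erase y ∉ Δ₀) :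
    CollapsesOnto Δ Δ₀ := by
  rcases isEmpty_or_nonempty E with hE | hE
  · have : Δ = Δ₀ := by
      refine le_antisymm (fun F hF => ?_) hle
      by_contra hF0
      obtain ⟨y, -⟩ := h _ ⟨F, hF, hF0, rfl⟩
      exact hE.elim y
    exact this ▸ Relation.ReflTransGen.refl
  choose! x hxp hx using h
  replace hxp : ∀ F ∈ Δ, F ∉ Δ₀ → ¬ p (x (F.filter p)) := fun F h1 h2 => hxp _ ⟨F, h1, h2, rfl⟩
  replace hx : ∀ F ∈ Δ, F ∉ Δ₀ → insert (x (F.filter p)) F ∈ Δ ∧ F.erase (x (F.filter p)) ∉ Δ₀ :=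
    fun F h1 h2 => hx _ ⟨F, h1, h2, rfl⟩ F h1 h2 rfl
  have hfin : Finite (Finset E) := by
    have := Fintype.ofFinite E
    infer_instance
  induction hn : (Δ : Set (Finset E)).ncard using Nat.strong_induction_on generalizing Δ with
  | _ n ih =>
  by_cases hne : Δ ≤ Δ₀
  · exact le_antisymm hle hne ▸ Relation.ReflTransGen.refl
  obtain ⟨F₁, hF₁, hF₁'⟩ := Set.not_subset.1 hne
  -- Maximal `F.filter p` first, then maximal `F`: such an `F` is the top of a free pair.
  obtain ⟨F, ⟨hF, hF0⟩, hmax⟩ := Set.exists_max_image {F | F ∈ Δ ∧ F ∉ Δ₀}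
    (fun F => toLex ((F.filter p).card, F.card)) (Set.toFinite _) ⟨F₁, hF₁, hF₁'⟩
  have hp := hxp F hF hF0
  obtain ⟨hins, hera⟩ := hx F hF hF0
  set y := x (F.filter p) with hy
  have hyF : y ∈ F := by
    by_contra hyF
    have := hmax _ ⟨hins, fun h => hF0 (Δ₀.lower (Finset.subset_insert _ _) h)⟩
    rw [Finset.filter_insert, if_neg hp, Prod.Lex.toLex_le_toLex] at this
    simp [Finset.card_insert_of_notMem hyF] at this
  have hfilt : (F.erase y).filter p = F.filter p := by
    ext z
    simp only [Finset.mem_filter, Finset.mem_erase]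
    exact ⟨fun h => ⟨h.1.2, h.2⟩, fun h => ⟨⟨fun hz => hp (hz ▸ h.2), h.1⟩, h.2⟩⟩
  have huniq : ∀ G ∈ Δ, F.erase y ⊂ G → G = F := by
    intro G hG hFG
    have hG0 : G ∉ Δ₀ := fun h => hera (Δ₀.lower hFG.subset h)
    have hsub : F.filter p ⊆ G.filter p := hfilt ▸ Finset.filter_subset_filter _ hFG.subset
    have h1 := hmax G ⟨hG, hG0⟩
    rw [Prod.Lex.toLex_le_toLex] at h1
    have hcard := Finset.card_le_card hsub
    have hTG : F.filter p = G.filter p :=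
      Finset.eq_of_subset_of_card_le hsub (by simp only at h1; omega)
    have hinsG := (hx G hG hG0).1
    rw [← hTG, ← hy] at hinsG
    have h2 := hmax _ ⟨hinsG, fun h => hG0 (Δ₀.lower (Finset.subset_insert _ _) h)⟩
    rw [Prod.Lex.toLex_le_toLex, Finset.filter_insert, if_neg hp, ← hTG] at h2
    have hFi : F = insert y G := by
      refine Finset.eq_of_subset_of_card_le ?_ (by simp only at h2; omega)
      rw [← Finset.insert_erase hyF]
      exact Finset.insert_subset_insert _ hFG.subset
    by_cases hyG : y ∈ G
    · rw [hFi, Finset.insert_eq_of_mem hyG]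
    · rw [hFi, Finset.erase_insert hyG] at hFG
      exact absurd rfl hFG.ne
  have hera' : F.erase y ∈ Δ := Δ.lower (Finset.erase_subset _ _) hF
  have hfree : IsFreePair Δ F (F.erase y) := by
    refine ⟨⟨hF, fun G hG hFG => ?_⟩, hera', Finset.erase_ssubset hyF,
      Finset.card_erase_add_one hyF, huniq⟩
    exact (huniq G hG ((Finset.erase_ssubset hyF).trans_subset hFG)).le
  let Δ' : SimplicialComplex E :=
    { carrier := (Δ : Set (Finset E)) \ {F, F.erase y}
      lower' := by
        rintro G H hHG ⟨hG, hGF⟩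
        refine ⟨Δ.lower hHG hG, ?_⟩
        simp only [Set.mem_insert_iff, Set.mem_singleton_iff, not_or] at hGF ⊢
        refine ⟨?_, ?_⟩
        · rintro rfl
          exact hGF.1 (huniq G hG ((Finset.erase_ssubset hyF).trans_subset hHG))
        · rintro rfl
          exact hGF.1 (huniq G hG (lt_of_le_of_ne hHG (Ne.symm hGF.2))) }
  have hmem : ∀ G, G ∈ Δ' ↔ G ∈ Δ ∧ G ≠ F ∧ G ≠ F.erase y := fun G => by
    change G ∈ (Δ : Set (Finset E)) \ {F, F.erase y} ↔ _
    simp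
  refine Relation.ReflTransGen.head (b := Δ') ⟨F, F.erase y, hfree, rfl⟩ ?_
  refine ih _ ?_ (fun G hG => ?_) (fun G hG hG0 => hxp G ((hmem G).1 hG).1 hG0)
    (fun G hG hG0 => ?_) rfl
  · rw [← hn]
    refine Set.ncard_lt_ncard ⟨Set.sdiff_subset, fun h => ?_⟩ (Set.toFinite _)
    exact ((hmem F).1 (h hF)).2.1 rfl
  · exact (hmem G).2 ⟨hle hG, fun h => hF0 (h ▸ hG), fun h => hera (h ▸ hG)⟩
  · obtain ⟨hG, hGF, hGF'⟩ := (hmem G).1 hG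
    have hpG := hxp G hG hG0
    obtain ⟨h1, h2⟩ := hx G hG hG0
    have hfG : (insert (x (G.filter p)) G).filter p = G.filter p := by
      rw [Finset.filter_insert, if_neg hpG]
    refine ⟨(hmem _).2 ⟨h1, fun h => ?_, fun h => ?_⟩, h2⟩
    · rw [h] at hfG
      rw [← hfG, ← hy] at h
      by_cases hyG : y ∈ G
      · exact hGF (by rw [← h, Finset.insert_eq_of_mem hyG])
      · exact hGF' (by rw [← h, Finset.erase_insert hyG])
    · rw [h, hfilt] at hfG
      rw [← hfG, ← hy] at h
      exact Finset.notMem_erase y F (h ▸ Finset.mem_insert_self y G)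

/-! ### Admissible diagonals through residues -/

/-- The residue of `a (k - i)` modulo `b`, for the diagonal `(i, k)`. Geometrically, a segment of
slope `a/b` from `(i, j)` to an east step with right endpoint `(k, m)` ends at horizontal distance
`residue / a` from that endpoint. -/
def residue (a b : ℕ) (d : ℕ × ℕ) : ℕ := a * (d.2 - d.1) % b

/-- The quotient of `a (k - i)` by `b`, for the diagonal `(i, k)`. Geometrically, it is the height
difference between the two ends of a laser with diagonal `(i, k)`. -/
def rise (a b : ℕ) (d : ℕ × ℕ) : ℕ := a * (d.2 - d.1) / b

variable {a b : ℕ}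

lemma rise_add_residue (a b : ℕ) (d : ℕ × ℕ) :
    b * rise a b d + residue a b d = a * (d.2 - d.1) := Nat.div_add_mod _ _

lemma residue_eq {d : ℕ × ℕ} {c r : ℕ} (h : b * c + r = a * (d.2 - d.1)) (hr : r < b) :
    residue a b d = r := by
  rw [residue, ← h, Nat.mul_add_mod, Nat.mod_eq_of_lt hr]

/-- The side of `(i, k)` with `k - i - 1` points gives the condition `c b / a < k - i < c b / a + 1`
for some `c`, which must be the rise; the condition on the other side then holds automatically, with
`a - c` in place of `c`. -/
theorem isAdmissible_iff (hab : a < b) (hcop : a.Coprime b) {d : ℕ × ℕ} :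
    IsAdmissible a b d ↔
      d.1 < d.2 ∧ d.2 ≤ b ∧ 0 < residue a b d ∧ residue a b d < a := by
  obtain ⟨i, k⟩ := d
  have hin (hik : i < k) (hk : k ≤ b) :
      ((Finset.range (b + 1)).filter fun p => i < p ∧ p < k).card = k - i - 1 := by
    rw [← Nat.card_Ioo]
    congr 1
    ext p
    simp
    omega
  have hout (hik : i < k) (hk : k ≤ b) :
      ((Finset.range (b + 1)).filter fun p => p < i ∨ k < p).card = b - (k - i) := by
    have : ((Finset.range (b + 1)).filter fun p => p < i ∨ k < p) =
        Finset.range (b + 1) \ Finset.Icc i k := by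
      ext p
      simp
      omega
    rw [this, Finset.card_sdiff_of_subset (by intro p; simp; omega), Nat.card_Icc,
      Finset.card_range]
    omega
  constructor
  · rintro ⟨⟨hik, hk, -, -⟩, hS, -⟩
    simp only at hik hk
    refine ⟨hik, hk, ?_⟩
    simp only [hin hik hk, S, Finset.mem_image, Finset.mem_Ico] at hS
    obtain ⟨c, ⟨hc1, hca⟩, hc⟩ := hS
    obtain ⟨l, hl⟩ : ∃ l, k - i = l + 1 := ⟨k - i - 1, by omega⟩
    rw [hl, Nat.add_sub_cancel] at hc
    have ha : 0 < a := by omega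
    have h1 : l * a ≤ c * b := hc ▸ Nat.div_mul_le_self _ _
    have h2 : c * b < (l + 1) * a := (Nat.div_lt_iff_lt_mul ha).1 (by omega)
    have h3 : l * a ≠ c * b := by
      intro h
      have : a ∣ c := hcop.dvd_of_dvd_mul_right (h ▸ Dvd.intro_left l rfl)
      exact absurd (Nat.le_of_dvd hc1 this) (by omega)
    have h4 : (l + 1) * a = l * a + a := by ring
    have hres : residue a b (i, k) = (l + 1) * a - c * b := by
      refine residue_eq (c := c) ?_ (by omega)
      simp only [hl]
      rw [mul_comm b c, mul_comm a]
      omega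
    omega
  · simp only
    rintro ⟨hik, hk, h0, ha⟩
    have hdiv := rise_add_residue a b (i, k)
    simp only at hdiv
    set c := rise a b (i, k)
    set r := residue a b (i, k)
    obtain ⟨l, hl⟩ : ∃ l, k - i = l + 1 := ⟨k - i - 1, by omega⟩
    have hlb : l + 1 ≠ b := by
      intro h
      have : r = 0 := by
        simp only [r, residue, hl, h, Nat.mul_mod_left]
      omega
    obtain ⟨q, hq⟩ : ∃ q, b = l + 1 + q := ⟨b - (l + 1), by omega⟩
    have hc1 : 1 ≤ c := by
      by_contra hc
      obtain hc : c = 0 := by omega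
      rw [hc, hl] at hdiv
      nlinarith
    have hca : c < a := by
      by_contra hc
      push Not at hc
      rw [hl] at hdiv
      nlinarith
    have hl1 : l ≠ 0 := by
      rintro rfl
      rw [hl] at hdiv
      nlinarith
    obtain ⟨f, hf⟩ := Nat.exists_eq_add_of_le hca.le
    refine ⟨⟨hik, hk, ?_, ?_⟩, ?_, ?_⟩
    · simp only
      omega
    · simp only
      omega
    · simp only [hin hik hk, S, Finset.mem_image, Finset.mem_Ico]
      refine ⟨c, ⟨hc1, hca⟩, ?_⟩
      rw [hl, Nat.add_sub_cancel]
      rw [hl] at hdiv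
      refine Nat.div_eq_of_lt_le ?_ ?_ <;> linarith
    · simp only [hout hik hk, S, Finset.mem_image, Finset.mem_Ico]
      refine ⟨f, ⟨by omega, by omega⟩, ?_⟩
      rw [hl] at hdiv
      rw [hl, show b - (l + 1) = q by omega]
      refine Nat.div_eq_of_lt_le ?_ ?_ <;> nlinarith

instance finite_admissibleDiagonal (a b : ℕ) : Finite (AdmissibleDiagonal a b) := by
  refine Set.Finite.subset ((Finset.range (b + 1) ×ˢ Finset.range (b + 1)).finite_toSet) ?_
  rintro ⟨i, k⟩ ⟨⟨h1, h2, -, -⟩, -, -⟩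
  simp only [Finset.coe_product, Finset.coe_range, Set.mem_prod, Set.mem_Iio] at *
  omega

/-! ### Clashing pairs and the collapse -/

/-- The diagonals `d = (i, k)` and `e = (i', k)` clash if `i < i'` and a laser with diagonal `d`
would pass above a laser with diagonal `e` that ends in the same east step, that is, the residue
of `e` is smaller than that of `d`. -/
def Clash (a b : ℕ) (d e : ℕ × ℕ) : Prop :=
  d.2 = e.2 ∧ d.1 < e.1 ∧ residue a b e < residue a b d

/-- The complex of the sets of mutually noncrossing admissible diagonals in which diagonals clash
only at right endpoints smaller than `k`. -/
def clashBelow (a b k : ℕ) : SimplicialComplex (AdmissibleDiagonal a b) where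
  carrier := {F | F ∈ AssHat a b ∧ ∀ d ∈ F, ∀ e ∈ F, Clash a b d.1 e.1 → d.1.2 < k}
  lower' := fun _ _ hGF hF =>
    ⟨(AssHat a b).lower hGF hF.1, fun d hd e he => hF.2 d (hGF hd) e (hGF he)⟩

/-- If `(i, k)` and `(i', k)` clash, then the third side `(i, i')` of their triangle is
admissible, its residue being the difference of theirs. -/
lemma Clash.isAdmissible (hab : a < b) (hcop : a.Coprime b) {d e : ℕ × ℕ}
    (hd : IsAdmissible a b d) (he : IsAdmissible a b e) (h : Clash a b d e) :
    IsAdmissible a b (d.1, e.1) := by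
  rw [isAdmissible_iff hab hcop] at *
  obtain ⟨h2, h1, hr⟩ := h
  have hD := rise_add_residue a b d
  have hE := rise_add_residue a b e
  have hle : rise a b e ≤ rise a b d :=
    Nat.div_le_div_right (Nat.mul_le_mul_left _ (by omega))
  obtain ⟨c, hc⟩ := Nat.exists_eq_add_of_le hle
  have hl : d.2 - d.1 = (e.1 - d.1) + (e.2 - e.1) := by omega
  rw [hl, mul_add, hc, mul_add] at hD
  have : residue a b (d.1, e.1) = residue a b d - residue a b e :=
    residue_eq (c := c) (by simp only; omega) (by omega)
  rw [this]
  simp only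
  omega

/-- Among the right endpoint `k` diagonals of a face, a clash can be chosen between neighbours:
the residues along the left endpoints from `d` to `e` have to drop somewhere. -/
lemma exists_adjacent_clash {T : Finset (AdmissibleDiagonal a b)} {k : ℕ}
    (hT : ∀ d ∈ T, d.1.2 = k) (h : ∃ d ∈ T, ∃ e ∈ T, Clash a b d.1 e.1) :
    ∃ d ∈ T, ∃ e ∈ T, Clash a b d.1 e.1 ∧ ∀ m ∈ T, ¬ (d.1.1 < m.1.1 ∧ m.1.1 < e.1.1) := by
  obtain ⟨d₀, hd₀, e₀, he₀, h₀⟩ := h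
  induction hn : e₀.1.1 - d₀.1.1 using Nat.strong_induction_on generalizing d₀ e₀ with
  | _ n ih =>
  by_cases hm : ∃ m ∈ T, d₀.1.1 < m.1.1 ∧ m.1.1 < e₀.1.1
  · obtain ⟨m, hmT, h1, h2⟩ := hm
    have := hT _ hd₀
    have := hT _ he₀
    have := hT _ hmT
    by_cases hr : residue a b m.1 < residue a b d₀.1
    · exact ih _ (by omega) d₀ hd₀ m hmT ⟨by omega, h1, hr⟩ rfl
    · exact ih _ (by omega) m hmT e₀ he₀ ⟨by omega, h2, by have := h₀.2.2; omega⟩ rfl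
  · push Not at hm
    exact ⟨d₀, hd₀, e₀, he₀, h₀, fun m hmT hm' => absurd hm'.2 (by have := hm m hmT hm'.1; omega)⟩

/-- Removing the clashes at the right endpoint `k`, by toggling the third side of the triangle
formed by two neighbouring clashing diagonals. -/
theorem clashBelow_succ_collapsesOnto (hab : a < b) (hcop : a.Coprime b) (k : ℕ) :
    CollapsesOnto (clashBelow a b (k + 1)) (clashBelow a b k) := by
  refine collapsesOnto_of_toggle (fun d => d.1.2 = k)
    (fun F hF => ⟨hF.1, fun d hd e he h => (hF.2 d hd e he h).trans k.lt_succ_self⟩) ?_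
  rintro T ⟨F, hF, hF0, rfl⟩
  have hclash : ∃ d ∈ F.filter (fun d => d.1.2 = k), ∃ e ∈ F.filter (fun d => d.1.2 = k),
      Clash a b d.1 e.1 := by
    by_contra hno
    refine hF0 ⟨hF.1, fun d hd e he h => ?_⟩
    have := hF.2 d hd e he h
    by_contra hk
    exact hno ⟨d, Finset.mem_filter.2 ⟨hd, by omega⟩, e,
      Finset.mem_filter.2 ⟨he, by have := h.1; omega⟩, h⟩
  obtain ⟨d, hdT, e, heT, hde, hadj⟩ :=
    exists_adjacent_clash (fun d hd => (Finset.mem_filter.1 hd).2) hclash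
  have hek : e.1.1 < k := by
    have := e.2.1.1
    have := (Finset.mem_filter.1 heT).2
    omega
  refine ⟨⟨(d.1.1, e.1.1), hde.isAdmissible hab hcop d.2 e.2⟩, ?_, fun G hG _ hGT => ?_⟩
  · simp only
    omega
  rw [← hGT] at hdT heT hadj
  obtain ⟨hdG, hdk⟩ := Finset.mem_filter.1 hdT
  obtain ⟨heG, hek'⟩ := Finset.mem_filter.1 heT
  set y : AdmissibleDiagonal a b := ⟨(d.1.1, e.1.1), hde.isAdmissible hab hcop d.2 e.2⟩
  have hy1 : y.1.1 = d.1.1 := rfl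
  have hy2 : y.1.2 = e.1.1 := rfl
  have hdlt := hde.2.1
  -- A diagonal crossing `y` crosses `d` or `e`, unless it joins `k` to a point between them.
  have hcross : ∀ m ∈ G, ¬ Cross y.1 m.1 := by
    intro m hm hym
    have h1 := hG.1 m hm d hdG
    have h2 := hG.1 m hm e heG
    have h3 := hadj m
    have h4 := m.2.1.1
    simp only [Finset.mem_filter, hm, true_and] at h3
    simp only [Cross] at *
    omega
  have hsymm : ∀ m ∈ G, ¬ Cross m.1 y.1 := by
    intro m hm hym
    exact hcross m hm (Or.symm hym)
  refine ⟨⟨?_, ?_⟩, ?_⟩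
  · intro m hm n hn
    rw [Finset.mem_insert] at hm hn
    rcases hm with rfl | hm <;> rcases hn with rfl | hn
    · simp only [Cross]
      omega
    · exact hcross n hn
    · exact hsymm m hm
    · exact hG.1 m hm n hn
  · intro m hm n hn hmn
    rw [Finset.mem_insert] at hm hn
    rcases hm with rfl | hm
    · omega
    · rcases hn with rfl | hn
      · have := hmn.1
        omega
      · exact hG.2 m hm n hn hmn
  · intro h
    have := h.2 d (Finset.mem_erase.2 ⟨fun h => ?_, hdG⟩) e
      (Finset.mem_erase.2 ⟨fun h => ?_, heG⟩) hde
    · omega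
    · have : d.1.2 = y.1.2 := by rw [h]
      omega
    · have : e.1.2 = y.1.2 := by rw [h]
      omega

theorem assHat_collapsesOnto_clashBelow_zero (hab : a < b) (hcop : a.Coprime b) :
    CollapsesOnto (AssHat a b) (clashBelow a b 0) := by
  have htop : AssHat a b = clashBelow a b (b + 1) :=
    le_antisymm (fun F hF => ⟨hF, fun d _ _ _ _ => Nat.lt_succ_of_le d.2.1.2.1⟩) fun F hF => hF.1
  rw [htop]
  induction b + 1 with
  | zero => exact Relation.ReflTransGen.refl
  | succ k ih => exact (clashBelow_succ_collapsesOnto hab hcop k).trans ih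

/-! ### The diagonals of a path neither cross nor clash -/

namespace DyckPath

lemma pt_mono (D : DyckPath a b) : Monotone D.pt :=
  Fin.monotone_iff_le_succ.2 fun t => by
    rcases D.step t with h | h <;> rw [h] <;> exact le_self_add

lemma mem_curve (D : DyckPath a b) (t : Fin (a + b)) {q : ℝ × ℝ}
    (hq : q ∈ segment ℝ (toPlane (D.pt t.castSucc)) (toPlane (D.pt t.succ))) : q ∈ D.curve :=
  Set.mem_iUnion.2 ⟨t, hq⟩

/-- A lattice form of the laser condition: the laser of `P` ends in an east step of `D` at some
height `m`, and the lattice points of `D` strictly between its two vertical lines lie strictly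
above it. -/
lemma IsLaserDiagonal.lattice (ha : 0 < a) (hb : 0 < b) {D : DyckPath a b} {P d : ℕ × ℕ}
    (hP : D.FiresLaser P) (hd : D.IsLaserDiagonal P d) :
    d.1 = P.1 ∧ ∃ (l m : ℕ) (t : Fin (a + b)), d.2 = l + 1 ∧
      D.pt t.castSucc = (l, m) ∧ D.pt t.succ = (l + 1, m) ∧
      (a : ℤ) * (l - P.1) < b * (m - P.2) ∧ (b : ℤ) * (m - P.2) < a * (l + 1 - P.1) ∧
      ∀ s, P.1 < (D.pt s).1 → (D.pt s).1 < l + 1 →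
        (a : ℤ) * ((D.pt s).1 - P.1) < b * ((D.pt s).2 - P.2) := by
  obtain ⟨i, j⟩ := P
  obtain ⟨i', k⟩ := d
  obtain ⟨-, R', s₀, hs₀, hs₀', hR'⟩ := hP
  obtain ⟨h1, ⟨q1, q2⟩, ⟨hq, hslope, -, hdisj⟩, ⟨l, m⟩, R, ⟨t, htL, htR, hR⟩, hQ, hk⟩ := hd
  subst hR hR'
  rw [openSegment_eq_image] at hQ
  obtain ⟨θ, ⟨hθ0, hθ1⟩, hθ⟩ := hQ
  simp only [toPlane, Prod.mk_add_mk, Prod.smul_mk, Prod.mk.injEq, smul_eq_mul,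
    add_zero, Nat.cast_add, Nat.cast_one] at *
  subst h1 hk
  obtain ⟨hx, hy⟩ := hθ
  have hbR : (0 : ℝ) < b := by exact_mod_cast hb
  have haR : (0 : ℝ) < a := by exact_mod_cast ha
  have hq2 : q2 = m := by linarith
  have hq1 : q1 = l + θ := by linarith
  have hmul : (b : ℝ) * (m - j) = a * (q1 - i') := by
    rw [← hq2, hslope]
    field_simp
  refine ⟨rfl, l, m, t, rfl, htL, htR, ?_, ?_, ?_⟩
  · have : (a : ℝ) * (l - i') < b * (m - j) := by
      rw [hmul]
      exact mul_lt_mul_of_pos_left (by linarith) haR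
    exact_mod_cast this
  · have : (b : ℝ) * (m - j) < a * (l + 1 - i') := by
      rw [hmul]
      exact mul_lt_mul_of_pos_left (by linarith) haR
    exact_mod_cast this
  -- The path starts above the laser and could only get below it by crossing it in an east step.
  have key : ∀ n, ∀ hn : n < a + b + 1, (s₀ : ℕ) + 1 ≤ n → (D.pt ⟨n, hn⟩).1 ≤ l →
      (a : ℤ) * ((D.pt ⟨n, hn⟩).1 - i') < b * ((D.pt ⟨n, hn⟩).2 - j) := by
    intro n hn hsn
    induction n, hsn using Nat.le_induction with
    | base =>
      intro _
      have : (⟨(s₀ : ℕ) + 1, hn⟩ : Fin (a + b + 1)) = s₀.succ := rfl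
      rw [this, hs₀']
      push_cast
      linarith
    | succ n hsn ih =>
      intro hl
      have hn' : n < a + b := by omega
      have e1 : (⟨n + 1, hn⟩ : Fin (a + b + 1)) = (⟨n, hn'⟩ : Fin (a + b)).succ := rfl
      have hpt := fun q => @mem_curve a b D ⟨n, hn'⟩ q
      have hle := D.pt_mono (show s₀.castSucc ≤ ⟨n, by omega⟩ from by
        rw [Fin.le_def]; simp only [Fin.val_castSucc]; omega)
      rw [hs₀] at hle
      specialize ih (by omega)
      have e2 : (⟨n, by omega⟩ : Fin (a + b + 1)) = (⟨n, hn'⟩ : Fin (a + b)).castSucc := rfl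
      rw [e1] at hl ⊢
      rw [e2] at ih hle
      rcases D.step ⟨n, hn'⟩ with hst | hst <;> rw [hst] at hl hpt ⊢ <;>
        generalize D.pt (Fin.castSucc ⟨n, hn'⟩) = z at * <;> obtain ⟨x, y⟩ := z
      · simp only [Prod.mk_add_mk, Nat.cast_add, Nat.cast_one, add_zero] at *
        specialize ih hl
        linarith
      · simp only [Prod.mk_add_mk, Nat.cast_add, Nat.cast_one, add_zero, Prod.mk_le_mk,
          toPlane] at *
        specialize ih (by omega)
        by_contra hcon
        push Not at hcon
        have ihR : (a : ℝ) * (x - i') < b * (y - j) := by exact_mod_cast ih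
        have hconR : (b : ℝ) * (y - j) ≤ a * (x + 1 - i') := by exact_mod_cast hcon
        have hlR : (x : ℝ) + 1 ≤ l := by exact_mod_cast hl
        have hxi : (i' : ℝ) ≤ x := by exact_mod_cast hle.1
        set w : ℝ := b * (y - j) / a with hw
        have hwa : a * w = b * (y - j) := by
          rw [hw]
          field_simp
        have hw1 : x - i' < w := by
          by_contra hc
          push Not at hc
          nlinarith
        have hw2 : w ≤ x + 1 - i' := by
          by_contra hc
          push Not at hc
          nlinarith
        have hno : ((i' : ℝ) + w, (y : ℝ)) ∈ openSegment ℝ ((i' : ℝ), (j : ℝ)) (q1, q2) →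
            ((i' : ℝ) + w, (y : ℝ)) ∉ D.curve := fun h => Set.disjoint_left.1 hdisj h
        refine hno ?_ (hpt _ ?_)
        · rw [openSegment_eq_image]
          have hpos : 0 < q1 - i' := by linarith
          refine ⟨w / (q1 - i'), ⟨div_pos (by linarith) hpos, ?_⟩, ?_⟩
          · rw [div_lt_one hpos]
            linarith
          · simp only [Prod.smul_mk, Prod.mk_add_mk, smul_eq_mul, Prod.mk.injEq]
            constructor
            · field_simp
              ring
            · have e : q2 = j + a / b * (q1 - i') := by linarith
              have e' : (y : ℝ) = j + a / b * w := by
                rw [hw]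
                field_simp
                ring
              rw [e, e']
              field_simp
              ring
        · rw [segment_eq_image]
          refine ⟨i' + w - x, ⟨by linarith, by linarith⟩, ?_⟩
          simp only [Prod.smul_mk, Prod.mk_add_mk, smul_eq_mul, Prod.mk.injEq]
          constructor <;> ring
  intro s hs1 hs2
  refine key s s.2 ?_ (by simp only [Fin.eta]; omega)
  by_contra hc
  have := D.pt_mono (show s ≤ s₀.castSucc from by
    rw [Fin.le_def]; simp only [Fin.val_castSucc]; omega)
  rw [hs₀] at this
  have := this.1
  simp only at this hs1
  omega

end DyckPath

/-- If two diagonals `(i, k)` and `(i', k')` with `i < i' < k` come from the same path, then the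
laser of the second starts above that of the first. Crossing would put the end of the first laser
both below and above it, and if `k = k'` the second laser ends closer to the right endpoint of the
common east step. -/
theorem ass_le_clashBelow_zero (ha : 0 < a) (hab : a < b) : Ass a b ≤ clashBelow a b 0 := by
  rintro F ⟨D, hD⟩
  have hb : 0 < b := by omega
  have hcross : ∀ d ∈ F, ∀ e ∈ F, ¬ (d.1.1 < e.1.1 ∧ e.1.1 < d.1.2 ∧ d.1.2 < e.1.2) := by
    rintro d hd e he ⟨h1, h2, h3⟩
    obtain ⟨P, hP, hPd⟩ := hD hd
    obtain ⟨P', hP', hPe⟩ := hD he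
    obtain ⟨hdP, l, m, t, hdl, -, htR, -, hlt, habv⟩ := hPd.lattice ha hb hP
    obtain ⟨heP, l', m', t', hel, -, -, -, -, habv'⟩ := hPe.lattice ha hb hP'
    obtain ⟨-, -, s, hs, -⟩ := hP'
    have e1 := habv s.castSucc (by rw [hs]; omega) (by rw [hs]; omega)
    have e2 := habv' t.succ (by rw [htR]; simp only; omega) (by rw [htR]; simp only; omega)
    rw [hs] at e1
    rw [htR] at e2
    push_cast at e2
    linarith
  refine ⟨fun d hd e he h => ?_, fun d hd e he h => ?_⟩
  · rcases h with h | h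
    · exact hcross d hd e he h
    · exact hcross e he d hd h
  · exfalso
    obtain ⟨P, hP, hPd⟩ := hD hd
    obtain ⟨P', hP', hPe⟩ := hD he
    obtain ⟨h2, h1, hr⟩ := h
    have hlt_e := e.2.1.1
    obtain ⟨hdP, l, m, t, hdl, htL, htR, hlo, hlt, habv⟩ := hPd.lattice ha hb hP
    obtain ⟨heP, l', m', t', hel, htL', htR', hlo', hlt', -⟩ := hPe.lattice ha hb hP'
    obtain rfl : l = l' := by omega
    obtain rfl : t = t' := by
      by_contra hne
      rcases lt_or_gt_of_ne hne with h | h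
      · have := (D.pt_mono (show t.succ ≤ t'.castSucc from h)).1
        rw [htR, htL'] at this
        simp at this
      · have := (D.pt_mono (show t'.succ ≤ t.castSucc from h)).1
        rw [htR', htL] at this
        simp at this
    obtain rfl : m = m' := by
      rw [htL] at htL'
      simpa using htL'
    obtain ⟨-, -, s, hs, -⟩ := hP'
    have e1 := habv s.castSucc (by rw [hs]; omega) (by rw [hs]; omega)
    rw [hs] at e1
    have hmP : P.2 ≤ m := by
      by_contra hc
      push Not at hc
      have : (m : ℤ) - P.2 < 0 := by omega
      have : (0 : ℤ) ≤ l - P.1 := by omega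
      nlinarith
    have hmP' : P'.2 ≤ m := by
      by_contra hc
      push Not at hc
      have : (m : ℤ) - P'.2 < 0 := by omega
      have : (0 : ℤ) ≤ l - P'.1 := by omega
      nlinarith
    -- The residues are read off from the endpoints of the two lasers.
    have res : ∀ (f : AdmissibleDiagonal a b) (Q : ℕ × ℕ), f.1.1 = Q.1 → f.1.2 = l + 1 → Q.2 ≤ m →
        (a : ℤ) * (l - Q.1) < b * (m - Q.2) → (b : ℤ) * (m - Q.2) < a * (l + 1 - Q.1) →
        (residue a b f.1 : ℤ) = a * (l + 1 - Q.1) - b * (m - Q.2) := by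
      intro f Q hf1 hf2 hQ hl1 hl2
      have hflt := f.2.1.1
      obtain ⟨r, hrr⟩ : ∃ r : ℕ, (r : ℤ) = a * (l + 1 - Q.1) - b * (m - Q.2) :=
        ⟨_, Int.toNat_of_nonneg (by omega)⟩
      rw [← hrr]
      congr 1
      refine residue_eq (c := m - Q.2) ?_ ?_
      · zify [hQ, hflt.le]
        rw [hrr, hf1, hf2]
        push_cast
        ring
      · zify
        rw [hrr]
        have : (a : ℤ) < b := by exact_mod_cast hab
        linarith
    have r1 := res d P hdP hdl hmP hlo hlt
    have r2 := res e P' heP hel hmP' hlo' hlt'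
    zify at hr
    rw [r1, r2] at hr
    linarith

/-! ### Paths with prescribed heights -/

namespace DyckPath

/-- The Dyck path that reaches the vertical line at `x` at height `H x`, and then goes north to the
height `H (x + 1)` of its next east step. As every lattice point on it has coordinate sum equal to
its index `t`, the first coordinate is the last `x` with `x + H x ≤ t`. -/
def ofHeights (H : ℕ → ℕ) (h0 : H 0 = 0) (hb : H b = a) (hmono : Monotone H)
    (habove : ∀ x ≤ b, a * x ≤ b * H x) : DyckPath a b where
  pt t := (Nat.findGreatest (fun x => x + H x ≤ t) b,
    t - Nat.findGreatest (fun x => x + H x ≤ t) b)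
  start := by
    have h : Nat.findGreatest (fun x => x + H x ≤ ((0 : Fin (a + b + 1)) : ℕ)) b = 0 := by
      rw [Nat.findGreatest_eq_zero_iff]
      intro n hn _
      simp only [Fin.val_zero]
      omega
    rw [h]
    simp
  finish := by
    have h : Nat.findGreatest (fun x => x + H x ≤ ((Fin.last (a + b)) : ℕ)) b = b := by
      rw [Nat.findGreatest_eq_iff]
      refine ⟨le_rfl, fun _ => ?_, fun n h1 h2 => absurd h1 (by omega)⟩
      simp only [Fin.val_last]
      omega
    rw [h]
    simp
  step t := by
    have hs := Nat.findGreatest_spec (P := fun x => x + H x ≤ (t : ℕ)) (n := b) (m := 0)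
      (Nat.zero_le _) (by omega)
    have hle := Nat.findGreatest_le (P := fun x => x + H x ≤ (t : ℕ)) b
    have hg := fun k => Nat.findGreatest_is_greatest (P := fun x => x + H x ≤ (t : ℕ))
      (n := b) (k := k)
    have hs' := Nat.findGreatest_spec (P := fun x => x + H x ≤ (t : ℕ) + 1) (n := b) (m := 0)
      (Nat.zero_le _) (by omega)
    have hle' := Nat.findGreatest_le (P := fun x => x + H x ≤ (t : ℕ) + 1) b
    have hmn : Nat.findGreatest (fun x => x + H x ≤ (t : ℕ)) b ≤
        Nat.findGreatest (fun x => x + H x ≤ (t : ℕ) + 1) b :=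
      Nat.le_findGreatest hle (by omega)
    simp only [Fin.val_succ, Fin.val_castSucc, Prod.mk_add_mk, Prod.mk.injEq, add_zero]
    set x := Nat.findGreatest (fun x => x + H x ≤ (t : ℕ)) b
    set x' := Nat.findGreatest (fun x => x + H x ≤ (t : ℕ) + 1) b
    have hx' : x' ≤ x + 1 := by
      by_contra hc
      have := hg (x + 1) (by omega) (by omega)
      have := hmono (show x + 1 ≤ x' by omega)
      omega
    omega
  above t := by
    have hs := Nat.findGreatest_spec (P := fun x => x + H x ≤ (t : ℕ)) (n := b) (m := 0)
      (Nat.zero_le _) (by omega)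
    have hle := Nat.findGreatest_le (P := fun x => x + H x ≤ (t : ℕ)) b
    simp only
    set x := Nat.findGreatest (fun x => x + H x ≤ (t : ℕ)) b
    exact (habove x hle).trans (Nat.mul_le_mul_left b (by omega))

section ofHeights

variable {H : ℕ → ℕ} (h0 : H 0 = 0) (hb : H b = a) (hmono : Monotone H)
  (habove : ∀ x ≤ b, a * x ≤ b * H x)

lemma height_le_ofHeights_pt (t : Fin (a + b + 1)) :
    H ((ofHeights H h0 hb hmono habove).pt t).1 ≤ ((ofHeights H h0 hb hmono habove).pt t).2 := by
  have hs := Nat.findGreatest_spec (P := fun x => x + H x ≤ (t : ℕ)) (n := b) (m := 0)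
    (Nat.zero_le _) (by omega)
  simp only [ofHeights]
  omega

lemma ofHeights_pt_eq {x y : ℕ} (hx : x ≤ b) (hy : H x ≤ y) (hy' : x < b → y ≤ H (x + 1))
    {t : Fin (a + b + 1)} (ht : (t : ℕ) = x + y) :
    (ofHeights H h0 hb hmono habove).pt t = (x, y) := by
  have h : Nat.findGreatest (fun x => x + H x ≤ (t : ℕ)) b = x := by
    rw [Nat.findGreatest_eq_iff]
    refine ⟨hx, fun _ => by omega, fun n h1 h2 => ?_⟩
    have := hmono (show x + 1 ≤ n by omega)
    have := hy' (by omega)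
    omega
  simp only [ofHeights, h, Prod.mk.injEq, true_and]
  omega

/-- A criterion for a diagonal to come from a laser of the path with heights `H`: the height `H k`
matches the laser, and the heights before `k` are above it. -/
lemma mem_facet_ofHeights (hapos : 0 < a) {i j k c : ℕ} (hik : i < k) (hk : k ≤ b)
    (hj : H i ≤ j) (hj' : j < H (i + 1)) (hij : (i, j) ≠ (0, 0)) (hHk : H k = j + c)
    (hlo : a * (k - i) < b * c + a) (hhi : b * c < a * (k - i))
    (hbetween : ∀ y, i < y → y < k → a * (y - i) + b * j < b * H y)
    (d : AdmissibleDiagonal a b) (hd : d.1 = (i, k)) :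
    d ∈ (ofHeights H h0 hb hmono habove).facet := by
  set D := ofHeights H h0 hb hmono habove with hD
  have hbpos : 0 < b := by omega
  have hHa : ∀ x ≤ b, H x ≤ a := fun x hx => hb ▸ hmono hx
  have hi1 := hHa (i + 1) (by omega)
  have hHka := hHa k hk
  obtain ⟨l, rfl⟩ : ∃ l, k = l + 1 := ⟨k - 1, by omega⟩
  have hHl : H l ≤ H (l + 1) := hmono (by omega)
  refine ⟨(i, j), ⟨hij, (i, j + 1), ⟨i + j, by omega⟩, ?_, ?_, rfl⟩, ?_⟩
  · exact ofHeights_pt_eq h0 hb hmono habove (by omega) hj (fun _ => by omega) rfl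
  · exact ofHeights_pt_eq h0 hb hmono habove (by omega) (by omega) (fun _ => by omega)
      (by simp only [Fin.val_succ]; omega)
  rw [hd]
  have ht1 : D.pt (Fin.castSucc ⟨l + H (l + 1), by omega⟩) = (l, H (l + 1)) :=
    ofHeights_pt_eq h0 hb hmono habove (by omega) hHl (fun _ => le_rfl) rfl
  have ht2 : D.pt (Fin.succ ⟨l + H (l + 1), by omega⟩) = (l + 1, H (l + 1)) :=
    ofHeights_pt_eq h0 hb hmono habove (by omega) le_rfl (fun _ => hmono (by omega))
      (by simp only [Fin.val_succ]; omega)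
  have haR : (0 : ℝ) < a := by exact_mod_cast hapos
  have hbR : (0 : ℝ) < b := by exact_mod_cast hbpos
  zify [hik.le] at hlo hhi
  set w : ℝ := b * c / a with hw
  have hwa : a * w = b * c := by
    rw [hw]
    field_simp
  have hw1 : l < i + w := by
    have : (a : ℝ) * (l + 1 - i) < b * c + a := by exact_mod_cast hlo
    by_contra hc
    push Not at hc
    nlinarith
  have hw2 : i + w < l + 1 := by
    have : (b : ℝ) * c < a * (l + 1 - i) := by exact_mod_cast hhi
    by_contra hc
    push Not at hc
    nlinarith
  have hil : (i : ℝ) ≤ l := by exact_mod_cast Nat.lt_succ_iff.1 hik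
  have hQ : (i + w, (H (l + 1) : ℝ)) ∈
      openSegment ℝ (toPlane (l, H (l + 1))) (toPlane (l + 1, H (l + 1))) := by
    rw [openSegment_eq_image]
    refine ⟨i + w - l, ⟨by linarith, by linarith⟩, ?_⟩
    simp only [toPlane, Prod.smul_mk, Prod.mk_add_mk, smul_eq_mul, Prod.mk.injEq]
    push_cast
    constructor <;> ring
  refine ⟨rfl, (i + w, H (l + 1)), ⟨?_, ?_, ?_, ?_⟩, (l, H (l + 1)), (l + 1, H (l + 1)),
    ⟨_, ht1, ht2, rfl⟩, hQ, rfl⟩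
  · simp only
    have : (0 : ℝ) < w := by
      by_contra hc
      linarith
    linarith
  · simp only [hHk, hw]
    push_cast
    field_simp
    ring
  · refine D.mem_curve ⟨l + H (l + 1), by omega⟩ ?_
    rw [ht1, ht2]
    exact openSegment_subset_segment _ _ _ hQ
  rw [Set.disjoint_left]
  rintro ⟨q1, q2⟩ hq hqD
  rw [openSegment_eq_image] at hq
  obtain ⟨θ, ⟨hθ0, hθ1⟩, hθ⟩ := hq
  simp only [toPlane, Prod.smul_mk, Prod.mk_add_mk, smul_eq_mul, Prod.mk.injEq] at hθ
  obtain ⟨hx, hy⟩ := hθ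
  have hwpos : 0 < w := by linarith
  have hx1 : q1 = i + θ * w := by rw [← hx]; ring
  have hy1 : q2 = j + θ * c := by rw [← hy, hHk]; push_cast; ring
  have hline : (a : ℝ) * (q1 - i) = b * (q2 - j) := by
    rw [hx1, hy1]
    linear_combination θ * hwa
  have hqi : (i : ℝ) < q1 := by rw [hx1]; nlinarith
  have hqw : q1 < i + w := by rw [hx1]; nlinarith
  -- A point of the laser lies strictly below the height of the path on a later vertical line.
  have habv : ∀ X : ℕ, q1 ≤ X → X < l + 1 → q2 < H X := by
    intro X hX1 hX2
    have hiX : i < X := by exact_mod_cast hqi.trans_le hX1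
    have := hbetween X hiX hX2
    zify [hiX.le] at this
    have hR : (a : ℝ) * (X - i) + b * j < b * H X := by exact_mod_cast this
    have : (a : ℝ) * (q1 - i) ≤ a * (X - i) := mul_le_mul_of_nonneg_left (by linarith) haR.le
    have : (b : ℝ) * q2 < b * H X := by linarith
    exact lt_of_mul_lt_mul_left this hbR.le
  obtain ⟨t, ht⟩ := Set.mem_iUnion.1 hqD
  have hH1 := height_le_ofHeights_pt h0 hb hmono habove t.castSucc
  have hH2 := height_le_ofHeights_pt h0 hb hmono habove t.succ
  rw [← hD] at hH1 hH2
  rw [segment_eq_image] at ht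
  obtain ⟨φ, ⟨hφ0, hφ1⟩, hφ⟩ := ht
  rcases D.step t with hst | hst <;> rw [hst] at hH2 hφ <;>
    generalize D.pt t.castSucc = z at * <;> obtain ⟨X, Y⟩ := z <;>
    simp only [toPlane, Prod.smul_mk, Prod.mk_add_mk, smul_eq_mul, Prod.mk.injEq, add_zero] at * <;>
    push_cast at hφ <;> obtain ⟨hX, hY⟩ := hφ
  · have hXq : q1 = X := by linarith
    have hXl : X < l + 1 := by
      have : (X : ℝ) < l + 1 := by linarith
      exact_mod_cast this
    have h1 := habv X hXq.le hXl
    have h2 : (H X : ℝ) ≤ Y := by exact_mod_cast hH1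
    linarith
  · have hYq : q2 = Y := by linarith
    have hXq : q1 = X + φ := by linarith
    have h2 : (H (X + 1) : ℝ) ≤ Y := by exact_mod_cast hH2
    by_cases hXl : X + 1 < l + 1
    · have := habv (X + 1) (by push_cast; linarith) hXl
      linarith
    · -- In the column of the east step ending at `k`, the path is at least as high as the laser's
      -- endpoint.
      have h3 : (H (l + 1) : ℝ) ≤ H (X + 1) := by exact_mod_cast hmono (by omega)
      have h4 : q2 < H (l + 1) := by
        rw [hHk]
        push_cast
        have : (0 : ℝ) < c := by
          have : 0 < (b : ℝ) * c := by rw [← hwa]; positivity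
          exact pos_of_mul_pos_right this hbR.le
        rw [hy1]
        nlinarith
      linarith

end ofHeights

end DyckPath

/-! ### Every set without crossings and clashes comes from a path -/

/-- The largest total rise of a chain of diagonals of `F` with disjoint interiors between the points
`y` and `b`, computed by recursion on the leftmost endpoint. -/
def maxRise (a b : ℕ) (F : Finset (ℕ × ℕ)) (y : ℕ) : ℕ :=
  if y < b then
    max (maxRise a b F (y + 1)) (F.sup fun d =>
      if d.1 = y ∧ y < d.2 then rise a b d + maxRise a b F d.2 else 0)
  else 0
termination_by b - y
decreasing_by all_goals omega

lemma maxRise_of_le (F : Finset (ℕ × ℕ)) {y : ℕ} (h : b ≤ y) : maxRise a b F y = 0 := by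
  rw [maxRise, if_neg (by omega)]

lemma maxRise_antitone (F : Finset (ℕ × ℕ)) : Antitone (maxRise a b F) := by
  refine antitone_nat_of_succ_le fun y => ?_
  by_cases h : y < b
  · rw [maxRise.eq_1 a b F y, if_pos h]
    exact le_max_left _ _
  · rw [maxRise_of_le F (by omega)]
    exact Nat.zero_le _

lemma rise_add_maxRise_le {F : Finset (ℕ × ℕ)} {d : ℕ × ℕ} (hd : d ∈ F) (h : d.1 < d.2)
    (hb : d.2 ≤ b) : rise a b d + maxRise a b F d.2 ≤ maxRise a b F d.1 := by
  rw [maxRise.eq_1 a b F d.1, if_pos (by omega)]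
  refine le_max_of_le_right ?_
  have := Finset.le_sup (f := fun e : ℕ × ℕ =>
    if e.1 = d.1 ∧ d.1 < e.2 then rise a b e + maxRise a b F e.2 else 0) hd
  simpa [h] using this

lemma maxRise_cases (F : Finset (ℕ × ℕ)) {y : ℕ} (h : y < b) :
    maxRise a b F y = maxRise a b F (y + 1) ∨ ∃ e ∈ F, e.1 = y ∧ y < e.2 ∧
      maxRise a b F y = rise a b e + maxRise a b F e.2 := by
  rw [maxRise.eq_1 a b F y, if_pos h]
  rcases le_total (F.sup fun d => if d.1 = y ∧ y < d.2 then rise a b d + maxRise a b F d.2 else 0)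
    (maxRise a b F (y + 1)) with hle | hle
  · exact Or.inl (max_eq_left hle)
  rw [max_eq_right hle]
  rcases F.eq_empty_or_nonempty with rfl | hne
  · left
    simp only [Finset.sup_empty, Nat.bot_eq_zero] at hle ⊢
    omega
  obtain ⟨e, he, heq⟩ := Finset.exists_mem_eq_sup F hne fun d =>
    if d.1 = y ∧ y < d.2 then rise a b d + maxRise a b F d.2 else 0
  rw [heq] at hle ⊢
  split_ifs at hle ⊢ with hc
  · exact Or.inr ⟨e, he, hc.1, hc.2, rfl⟩
  · left
    omega

lemma mul_maxRise_le {F : Finset (ℕ × ℕ)} (hF : ∀ d ∈ F, d.1 < d.2 ∧ d.2 ≤ b) {y : ℕ}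
    (hy : y ≤ b) : b * maxRise a b F y + a * y ≤ a * b := by
  induction hn : b - y using Nat.strong_induction_on generalizing y with
  | _ n ih =>
  rcases hy.eq_or_lt with rfl | hlt
  · rw [maxRise_of_le F le_rfl]
    simp
  rcases maxRise_cases (a := a) F hlt with h | ⟨e, he, rfl, hlt', h⟩
  · have := ih _ (by omega) (show y + 1 ≤ b by omega) rfl
    rw [h]
    linarith
  · have h1 := ih _ (by have := hF e he; omega) (hF e he).2 rfl
    have h2 := rise_add_residue a b e
    zify [hlt'.le] at *
    rw [h]
    linarith

/-- Under a diagonal `d = (i, k)` of a set without crossings and clashes, chains starting at `y`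
stay strictly below the line of the laser of `d`: each diagonal of a chain loses its residue, and
the loss exceeds that of `d` if the chain reaches `k`, whereas a chain that misses `k` loses at
least `a`. -/
lemma mul_maxRise_lt {F : Finset (ℕ × ℕ)}
    (hF : ∀ d ∈ F, d.1 < d.2 ∧ d.2 ≤ b ∧ residue a b d < a)
    (hcross : ∀ d ∈ F, ∀ e ∈ F, ¬ Cross d e)
    (hclash : ∀ d ∈ F, ∀ e ∈ F, d.2 = e.2 → d.1 < e.1 → residue a b d < residue a b e)
    {d : ℕ × ℕ} (hd : d ∈ F) {y : ℕ} (hy : d.1 < y) (hy' : y < d.2) :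
    b * maxRise a b F y + residue a b d + a * y < b * maxRise a b F d.2 + a * d.2 := by
  induction hn : d.2 - y using Nat.strong_induction_on generalizing y with
  | _ n ih =>
  have hFd := hF d hd
  rcases maxRise_cases (a := a) F (show y < b by omega) with h | ⟨e, he, rfl, hlt, h⟩
  · rw [h]
    rcases Nat.lt_or_ge (y + 1) d.2 with h1 | h1
    · have := ih _ (by omega) (by omega) h1 rfl
      linarith
    · obtain hk : d.2 = y + 1 := by omega
      rw [hk]
      linarith
  · have h2 := rise_add_residue a b e
    have hed : e.2 ≤ d.2 := by
      by_contra hc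
      exact hcross d hd e he (Or.inl (by omega))
    rcases hed.eq_or_lt with h3 | h3
    · have h4 := hclash d hd e he h3.symm hy
      rw [h, ← h3]
      zify [hlt.le] at *
      linarith
    · have h4 := ih _ (by omega) (by omega) h3 rfl
      rw [h]
      zify [hlt.le] at *
      linarith

/-- The path that reaches the vertical line at `y > 0` at height `a - maxRise y` has all diagonals of
the given set: the laser of `(i, k)` starts at height `a - maxRise k - rise (i, k)`. -/
theorem clashBelow_zero_le_ass (ha : 0 < a) (hab : a < b) (hcop : a.Coprime b) :
    clashBelow a b 0 ≤ Ass a b := by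
  rintro F ⟨hcross, hclash⟩
  set G : Finset (ℕ × ℕ) := F.image Subtype.val with hG
  have hGF : ∀ d ∈ G, ∃ h : IsAdmissible a b d, ⟨d, h⟩ ∈ F := by simp [hG]
  have hadm : ∀ d ∈ G, d.1 < d.2 ∧ d.2 ≤ b ∧ 0 < residue a b d ∧ residue a b d < a :=
    fun d hd => (isAdmissible_iff hab hcop).1 (hGF d hd).1
  have hcrossG : ∀ d ∈ G, ∀ e ∈ G, ¬ Cross d e := fun d hd e he =>
    hcross _ (hGF d hd).2 _ (hGF e he).2
  have hclashG : ∀ d ∈ G, ∀ e ∈ G, d.2 = e.2 → d.1 < e.1 → residue a b d < residue a b e := by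
    intro d hd e he h2 h1
    have hle : residue a b d ≤ residue a b e := by
      by_contra hc
      exact absurd (hclash _ (hGF d hd).2 _ (hGF e he).2 ⟨h2, h1, by simpa using hc⟩)
        (Nat.not_lt_zero _)
    refine lt_of_le_of_ne hle fun heq => ?_
    -- Equal residues would make `b` divide `a (i' - i)`, hence `i' - i`.
    have hmod : a * (d.2 - d.1) ≡ a * (e.2 - e.1) [MOD b] := heq
    have hmod' := Nat.ModEq.cancel_left_of_coprime hcop.symm hmod
    have := hadm d hd
    have := hadm e he
    have h3 : d.2 - d.1 = e.2 - e.1 := by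
      refine Nat.ModEq.eq_of_lt_of_lt hmod' ?_ ?_
      · by_contra hc
        have : d.2 - d.1 = b := by omega
        simp [residue, this] at *
      · omega
    omega
  have hbd : ∀ y ≤ b, b * maxRise a b G y + a * y ≤ a * b := fun y hy =>
    mul_maxRise_le (fun d hd => ⟨(hadm d hd).1, (hadm d hd).2.1⟩) hy
  have hlt := fun d hd y => mul_maxRise_lt (y := y)
    (fun d hd => ⟨(hadm d hd).1, (hadm d hd).2.1, (hadm d hd).2.2.2⟩) hcrossG hclashG (d := d) hd
  have hua : ∀ y, maxRise a b G y ≤ a := fun y => by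
    refine (maxRise_antitone G (Nat.zero_le y)).trans ?_
    have := hbd 0 (Nat.zero_le b)
    nlinarith
  set u := maxRise a b G
  have hanti : Antitone u := maxRise_antitone G
  have hub : u b = 0 := maxRise_of_le G le_rfl
  let H : ℕ → ℕ := fun y => if y = 0 then 0 else a - u y
  have hHpos : ∀ y, 0 < y → H y = a - u y := fun y hy => if_neg (by omega)
  have h0 : H 0 = 0 := if_pos rfl
  have hb : H b = a := by rw [hHpos b (by omega), hub, Nat.sub_zero]
  have hmono : Monotone H := by
    refine monotone_nat_of_le_succ fun y => ?_
    rcases Nat.eq_zero_or_pos y with rfl | hy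
    · rw [h0]
      exact Nat.zero_le _
    · rw [hHpos y hy, hHpos _ (by omega)]
      exact Nat.sub_le_sub_left (hanti y.le_succ) a
  have habove : ∀ x ≤ b, a * x ≤ b * H x := by
    intro x hx
    rcases Nat.eq_zero_or_pos x with rfl | hx0
    · simp
    · rw [hHpos x hx0]
      have h1 := hbd x hx
      have h2 := hua x
      zify [h2] at *
      linarith
  refine ⟨DyckPath.ofHeights H h0 hb hmono habove, fun d hd => ?_⟩
  have hdG : d.1 ∈ G := Finset.mem_image_of_mem _ hd
  obtain ⟨hik, hk, hr0, hra⟩ := hadm _ hdG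
  have hle : rise a b d.1 + u d.1.2 ≤ u d.1.1 := rise_add_maxRise_le hdG hik hk
  have hrise := rise_add_residue a b d.1
  have hlt := hlt _ hdG
  obtain ⟨⟨i, k⟩, hdadm⟩ := d
  simp only at *
  set c := rise a b (i, k)
  set r := residue a b (i, k)
  have hui := hua i
  have huk := hua k
  have hHk : H k = a - u k := hHpos k (by omega)
  have hik1 : i + 1 < k := by
    by_contra hc
    have h1 : k - i = 1 := by omega
    have hc0 : c = 0 := by
      by_contra hc0
      have : b * 1 ≤ b * c := Nat.mul_le_mul_left b (by omega)
      rw [h1] at hrise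
      omega
    rw [h1, hc0] at hrise
    omega
  have hjR : ((a - u k - c : ℕ) : ℤ) = a - u k - c := by omega
  zify [hik.le] at hrise
  refine DyckPath.mem_facet_ofHeights h0 hb hmono habove ha (j := a - u k - c) (c := c) hik hk
    ?_ ?_ ?_ ?_ ?_ ?_ ?_ _ rfl
  · rcases Nat.eq_zero_or_pos i with rfl | hi
    · rw [h0]
      exact Nat.zero_le _
    · rw [hHpos i hi]
      omega
  · rw [hHpos (i + 1) (by omega)]
    have h1 := hlt (i + 1) (by omega) hik1
    have h2 : u (i + 1) < u k + c := by
      zify at h1 ⊢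
      nlinarith
    omega
  · intro h
    obtain ⟨rfl, hj⟩ := Prod.mk.injEq .. ▸ h
    have h1 := hbd k hk
    have h2 : a ≤ u k + c := by omega
    zify at h1 h2 hr0
    push_cast at hrise
    nlinarith
  · rw [hHk]
    omega
  · zify [hik.le]
    zify at hra
    linarith
  · zify [hik.le]
    zify at hr0
    linarith
  · intro y hy1 hy2
    rw [hHpos y (by omega)]
    have h1 := hlt y hy1 hy2
    have h2 := hua y
    zify [hy1.le, h2] at h1 ⊢
    rw [hjR]
    linarith

end RationalAss

theorem theorem1p1 (a b : ℕ) (ha : 0 < a) (hab : a < b) (hcop : Nat.Coprime a b) :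
    RationalAss.CollapsesOnto (RationalAss.AssHat a b) (RationalAss.Ass a b) := by
  have h := RationalAss.assHat_collapsesOnto_clashBelow_zero hab hcop
  rwa [le_antisymm (RationalAss.clashBelow_zero_le_ass ha hab hcop)
    (RationalAss.ass_le_clashBelow_zero ha hab)] at h
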